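/- Let $r,c\ge 1$ and let $A_1,\dots,A_c$ be undirected simple graphs on the vertex set $[r]$ with edge weights in $\{\pm1\}$ (atoms), such that the adjacency matrix of every $A_j$ has exactly the two distinct eigenvalues $\lambda_1\ne\lambda_2$ (the same pair for every $j$). For each $n$, let $\mathcal I_n$ be a random additive $n$-lift of $(A_1,\dots,A_c)$ with $1$-wise uniform negations, defined as follows. Its vertex set is $V_n=[r]\times[n]$. Choose independent uniformly random permutations $\sigma_{ij}$ of $[n]$, $(i,j)\in[r]\times[c]$ (a random $n$-lift of the complete bipartite graph $K_{r,c}$); the constraint vertices are the pairs $f=(j,b)\in[c]\times[n]$, and $f=(j,b)$ is joined to those $(i,a)\in V_n$ with $\sigma_{ij}(a)=b$. Independently of the lift, choose signs $\xi^{(f)}_i\in\{\pm1\}$, $i\in[r]$, such that each $\xi^{(f)}_i$ is uniform on $\{\pm1\}$, the signs with the same $f$ may be arbitrarily correlated, and the vectors $(\xi^{(f)}_i)_{i\in[r]}$ are independent for different $f$. The adjacency matrix $A_{\mathcal I_n}$ has the entries $$A_{\mathcal I_n}[(i,a),(i',a')]=\sum_{\substack{f=(j,b)\\ \sigma_{ij}(a)=b=\sigma_{i'j}(a')}}\xi^{(f)}_i\,\xi^{(f)}_{i'}\,A_j[i,i'].$$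 Then for every $\varepsilon>0$, with probability $1-o(1)$ as $n\to\infty$, there are real positive semidefinite $V_n\times V_n$ matrices $M_+$ and $M_-$ with all-ones diagonals such that $$\langle A_{\mathcal I_n},M_+\rangle\ \ge\ \bigl(\lambda_1+\lambda_2+2\sqrt{(c-1)(-\lambda_1\lambda_2)}-\varepsilon\bigr)\,|V_n|,$$ $$\langle A_{\mathcal I_n},M_-\rangle\ \le\ \bigl(\lambda_1+\lambda_2-2\sqrt{(c-1)(-\lambda_1\lambda_2)}+\varepsilon\bigr)\,|V_n|,$$ where $\langle A,M\rangle=\sum_{u,v}A_{uv}M_{uv}$ and $|V_n|=rn$. -/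

import Mathlib

open MeasureTheory ProbabilityTheory

/-- An atom on the vertex set `[r]`: an undirected simple graph with edge weights `±1`, given by its
adjacency matrix (the entry `0` means that there is no edge). -/
structure Atom (r : ℕ) where
  adj : Matrix (Fin r) (Fin r) ℝ
  symm : adj.IsSymm
  loopless : ∀ i, adj i i = 0
  weight : ∀ i j, adj i j = 0 ∨ adj i j = 1 ∨ adj i j = -1

/-- The variable vertices of an `n`-fold lift of `K_{r,c}`: `r` groups of size `n`. -/
abbrev VarVertex (r n : ℕ) : Type := Fin r × Fin n

/-- The constraint vertices of an `n`-fold lift of `K_{r,c}`: `c` groups of size `n`. -/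
abbrev ConVertex (c n : ℕ) : Type := Fin c × Fin n

/-- An `r`-ary, `c`-atom constraint graph: an `n`-fold lift of the complete bipartite graph
`K_{r,c}`, given by one permutation of `[n]` for every edge `(i, j)` of `K_{r,c}`. -/
def ConstraintGraph (r c n : ℕ) : Type := Fin r → Fin c → Equiv.Perm (Fin n)

namespace ConstraintGraph

instance (r c n : ℕ) : Fintype (ConstraintGraph r c n) :=
  inferInstanceAs (Fintype (Fin r → Fin c → Equiv.Perm (Fin n)))

instance (r c n : ℕ) : MeasurableSpace (ConstraintGraph r c n) := ⊤

/-- Adjacency in the constraint graph: the variable vertex `(i, a)` is joined to the constraint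
vertex `(j, b)` if and only if the permutation on the edge `(i, j)` maps `a` to `b`. -/
def Incident {r c n : ℕ} (K : ConstraintGraph r c n) (v : VarVertex r n) (f : ConVertex c n) :
    Prop :=
  K v.1 f.1 v.2 = f.2

instance {r c n : ℕ} (K : ConstraintGraph r c n) (v : VarVertex r n) (f : ConVertex c n) :
    Decidable (K.Incident v f) :=
  inferInstanceAs (Decidable (K v.1 f.1 v.2 = f.2))

/-- The adjacency matrix of the instance graph with negations: every constraint vertex `f` of
group `j` places a copy of the atom `A j` on its neighbours, the edge `{i, i'}` having its weight
multiplied by `ξ f i * ξ f i'`.  The weights of parallel edges are added. -/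
def instanceAdj {r c n : ℕ} (K : ConstraintGraph r c n) (A : Fin c → Atom r)
    (ξ : ConVertex c n → Fin r → ℤˣ) : Matrix (VarVertex r n) (VarVertex r n) ℝ :=
  fun v w => ∑ f : ConVertex c n,
    if K.Incident v f ∧ K.Incident w f then
      (((ξ f v.1 * ξ f w.1 : ℤˣ) : ℤ) : ℝ) * (A f.1).adj v.1 w.1
    else 0

end ConstraintGraph

/-- `K` and `ξ` are the constraint graph and the signs of a random additive `n`-lift with `1`-wise
uniform negations: `K` is a uniformly random `n`-lift of `K_{r,c}` (independent uniform
permutations on the edges), each single sign `ξ f i` is uniform on `{±1}` (with arbitrary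
correlations for a fixed `f`), the sign vectors of different constraint vertices are independent,
and the signs are independent of the lift. -/
structure IsRandomNegatedLift {Ω : Type*} [MeasurableSpace Ω] (μ : Measure Ω) {r c n : ℕ}
    (K : Ω → ConstraintGraph r c n) (ξ : Ω → ConVertex c n → Fin r → ℤˣ) : Prop where
  measurable_lift : Measurable K
  measurable_sign : Measurable ξ
  lift_uniform : μ.map K = uniformOn Set.univ
  sign_uniform : ∀ f i s, μ {ω | ξ ω f i = s} = 1 / 2
  sign_indep : iIndepFun (fun f ω => ξ ω f) μ
  lift_indep_sign : IndepFun K ξ μ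

/-- `M` is positive semidefinite with all-ones diagonal. -/
def IsSDPFeasible {V : Type*} [Fintype V] (M : Matrix V V ℝ) : Prop :=
  M.PosSemidef ∧ ∀ v, M v v = 1

/-- The entrywise inner product `⟨A, M⟩` of real matrices. -/
def matInner {V : Type*} [Fintype V] (A M : Matrix V V ℝ) : ℝ :=
  ∑ u, ∑ v, A u v * M u v

/-! Put `s = λ₁ + λ₂`, `d = -λ₁λ₂`, `γ = d(c - 1)`. The adjacency matrix is a sum of blocks `B f`,
one per constraint vertex, each satisfying `B f² = s B f + d E f` with `E f` a coordinate projection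
and `∑ E f = c`. These relations alone turn the sums of nonbacktracking products of blocks into
polynomials in the adjacency matrix, with Jacobi coefficients `s` and `γ` beyond degree zero
(`aeval_jacobiPoly_eq_sum_nonbacktrackingSum`). At a vertex on no short cycle these polynomials have
zero diagonal, so the diagonal functional there agrees to high degree with the spectral measure of
the universal cover, whose Jacobi matrix is tridiagonal Toeplitz from degree one on.

The flat vector of length `L + 1` with signs `σ ^ k` has Rayleigh quotient `s + 2σ√γ L/(L + 1)`
there. The corresponding polynomial `q` of the adjacency matrix gives the solution `q(A)² / (L + 1)`
on the good vertices and the identity elsewhere (`exists_isSDPFeasible_of_jacobi`); taking `σ = ±1`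
yields the two ends.

Bad vertices are rare: a switching argument shows that a reduced word in random permutations fixes a
given point with probability `O(1/n)` (`card_trail_eq_mul_le`), and Markov's inequality finishes. -/

/-! ### Orthogonal polynomials and the test polynomial. -/

/-- The monic orthogonal polynomials with Jacobi coefficients `α₀ = 0`, `αₖ = s` for `k ≥ 1`
and `βₖ = β k`. -/
noncomputable def jacobiPoly (s : ℝ) (β : ℕ → ℝ) : ℕ → Polynomial ℝ
  | 0 => 1
  | 1 => Polynomial.X
  | k + 2 => (Polynomial.X - Polynomial.C s) * jacobiPoly s β (k + 1)
      - Polynomial.C (β k) * jacobiPoly s β k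

theorem X_mul_jacobiPoly (s : ℝ) (β : ℕ → ℝ) (k : ℕ) :
    Polynomial.X * jacobiPoly s β (k + 1) = jacobiPoly s β (k + 2)
      + s • jacobiPoly s β (k + 1) + β k • jacobiPoly s β k := by
  rw [jacobiPoly, Polynomial.smul_eq_C_mul, Polynomial.smul_eq_C_mul]
  ring

/-- The squared norms of the polynomials `jacobiPoly s β k`. -/
def jacobiNorm (β : ℕ → ℝ) : ℕ → ℝ
  | 0 => 1
  | k + 1 => β k * jacobiNorm β k

/-- A functional that kills `jacobiPoly s β k` for `1 ≤ k ≤ N` makes these polynomials orthogonal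
up to total degree `N`. -/
theorem jacobiPoly_orthogonal (s : ℝ) (β : ℕ → ℝ) (φ : Polynomial ℝ →ₗ[ℝ] ℝ) (N : ℕ)
    (h0 : φ 1 = 1) (hφ : ∀ k, 1 ≤ k → k ≤ N → φ (jacobiPoly s β k) = 0) (k : ℕ) :
    ∀ l, k + l ≤ N → φ (jacobiPoly s β k * jacobiPoly s β l) =
      if k = l then jacobiNorm β k else 0 := by
  induction k using Nat.strong_induction_on with
  | _ k ih =>
  match k with
  | 0 =>
    intro l hl
    rcases l with _ | l
    · simp [jacobiPoly, jacobiNorm, h0]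
    · simpa [jacobiPoly] using hφ (l + 1) (by omega) (by omega)
  | 1 =>
    intro l hl
    rcases l with _ | l
    · simpa [jacobiPoly] using hφ 1 le_rfl (by omega)
    · have h1 : jacobiPoly s β 1 = Polynomial.X := rfl
      rw [h1, X_mul_jacobiPoly, map_add, map_add, map_smul, map_smul, hφ (l + 2) (by omega) (by omega),
        hφ (l + 1) (by omega) (by omega)]
      rcases l with _ | l
      · simp [jacobiPoly, jacobiNorm, h0]
      · simp [hφ (l + 1) (by omega) (by omega)]
  | k + 2 =>
    intro l hl
    -- The recurrence moves one factor `X` from the left polynomial to the right one, so the total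
    -- degree never exceeds `k + 2 + l`.
    have hrec : jacobiPoly s β (k + 2) * jacobiPoly s β l =
        jacobiPoly s β (k + 1) * (Polynomial.X * jacobiPoly s β l)
        - s • (jacobiPoly s β (k + 1) * jacobiPoly s β l)
        - β k • (jacobiPoly s β k * jacobiPoly s β l) := by
      rw [jacobiPoly, Polynomial.smul_eq_C_mul, Polynomial.smul_eq_C_mul]
      ring
    rw [hrec, map_sub, map_sub, map_smul, map_smul, ih (k + 1) (by omega) l (by omega),
      ih k (by omega) l (by omega)]
    rcases l with _ | l
    · have hX : Polynomial.X * jacobiPoly s β 0 = jacobiPoly s β 1 := by simp [jacobiPoly]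
      rw [hX, ih (k + 1) (by omega) 1 (by omega)]
      rcases k with _ | k
      · simp [jacobiNorm]
      · simp
    · rw [X_mul_jacobiPoly, mul_add, mul_add, mul_smul_comm, mul_smul_comm, map_add, map_add,
        map_smul, map_smul, ih (k + 1) (by omega) (l + 2) (by omega),
        ih (k + 1) (by omega) (l + 1) (by omega), ih (k + 1) (by omega) l (by omega)]
      by_cases h1 : k = l
      · subst h1; simp
      by_cases h2 : k = l + 1
      · subst h2; simp [jacobiNorm]; omega
      by_cases h3 : k + 1 = l
      · subst h3; simp [jacobiNorm]; omega
      simp [h1, h2, h3]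

/-- The matrix coefficients of multiplication by `X` in the basis `jacobiPoly s β (k + 1)`. -/
theorem jacobiPoly_X_mul_mul (s : ℝ) (β : ℕ → ℝ) (φ : Polynomial ℝ →ₗ[ℝ] ℝ) (N : ℕ)
    (h0 : φ 1 = 1) (hφ : ∀ k, 1 ≤ k → k ≤ N → φ (jacobiPoly s β k) = 0) (k l : ℕ)
    (hkl : k + l + 3 ≤ N) :
    φ (Polynomial.X * (jacobiPoly s β (k + 1) * jacobiPoly s β (l + 1))) =
      (if k = l then s * jacobiNorm β (k + 1) else 0)
      + (if k + 1 = l then jacobiNorm β (l + 1) else 0)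
      + (if l + 1 = k then jacobiNorm β (k + 1) else 0) := by
  have h := jacobiPoly_orthogonal s β φ N h0 hφ
  rw [← mul_assoc, X_mul_jacobiPoly, add_mul, add_mul, smul_mul_assoc, smul_mul_assoc, map_add,
    map_add, map_smul, map_smul, h (k + 2) (l + 1) (by omega), h (k + 1) (l + 1) (by omega),
    h k (l + 1) (by omega)]
  by_cases h1 : k = l
  · subst h1; simp
  by_cases h2 : k = l + 1
  · subst h2
    have h4 : ¬ (l + 1 + 1 = l) := by omega
    simp [jacobiNorm, h4]
  by_cases h3 : k + 1 = l
  · subst h3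
    have h4 : ¬ (k + 1 + 1 = k) := by omega
    simp [h2, h4]
  have h4 : ¬ (l + 1 = k) := fun h => h2 h.symm
  simp [h1, h2, h3, h4]

/-- The flat combination of the first `L` normalized polynomials, with signs `σ ^ k`. -/
noncomputable def testPoly (s : ℝ) (β : ℕ → ℝ) (σ : ℝ) (L : ℕ) : Polynomial ℝ :=
  ∑ k ∈ Finset.range L, (σ ^ k / √(jacobiNorm β (k + 1))) • jacobiPoly s β (k + 1)

theorem apply_testPoly_sq (s : ℝ) (β : ℕ → ℝ) (σ : ℝ) (hσ : σ ^ 2 = 1) (L : ℕ)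
    (hpos : ∀ k < L, 0 < β k) (φ : Polynomial ℝ →ₗ[ℝ] ℝ) (N : ℕ) (hN : 2 * L + 1 ≤ N)
    (h0 : φ 1 = 1) (hφ : ∀ k, 1 ≤ k → k ≤ N → φ (jacobiPoly s β k) = 0) :
    φ (testPoly s β σ L * testPoly s β σ L) = L := by
  have hn : ∀ k ≤ L, 0 < jacobiNorm β k := by
    intro k hk
    induction k with
    | zero => simp [jacobiNorm]
    | succ k ih => exact mul_pos (hpos k (by omega)) (ih (by omega))
  have h := jacobiPoly_orthogonal s β φ N h0 hφ
  rw [testPoly, Finset.sum_mul_sum, map_sum]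
  have : ∀ k ∈ Finset.range L, φ (∑ l ∈ Finset.range L,
      (σ ^ k / √(jacobiNorm β (k + 1))) • jacobiPoly s β (k + 1) *
      (σ ^ l / √(jacobiNorm β (l + 1))) • jacobiPoly s β (l + 1)) = 1 := by
    intro k hk
    have hk' := Finset.mem_range.1 hk
    rw [map_sum, Finset.sum_eq_single_of_mem k hk]
    · have hp := hn (k + 1) (by omega)
      rw [smul_mul_smul_comm, map_smul, h _ _ (by omega), if_pos rfl, smul_eq_mul, div_mul_div_comm,
        Real.mul_self_sqrt hp.le, ← mul_pow, ← sq, hσ, one_pow, one_div_mul_cancel hp.ne']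
    · intro l hl hne
      have := Finset.mem_range.1 hl
      rw [smul_mul_smul_comm, map_smul, h _ _ (by omega), if_neg (by omega), smul_zero]
  rw [Finset.sum_congr rfl this]
  simp

/-- In the normalized basis from degree 1 on, multiplication by `X` has diagonal `s` and
off-diagonal `√γ`; degree 0 is left out because `α₀` and `β 0` are exceptional. The `L` neighbouring
pairs each count twice with sign `σ ^ (2k + 1) = σ`. The top degree is `2(L + 1) + 1`, whence the
bound on `N`. -/
theorem apply_X_mul_testPoly_sq (s : ℝ) (β : ℕ → ℝ) (γ : ℝ) (hγ : ∀ k, β (k + 1) = γ)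
    (σ : ℝ) (hσ : σ ^ 2 = 1) (L : ℕ)
    (hpos : ∀ k < L + 1, 0 < β k) (φ : Polynomial ℝ →ₗ[ℝ] ℝ) (N : ℕ) (hN : 2 * (L + 1) + 1 ≤ N)
    (h0 : φ 1 = 1) (hφ : ∀ k, 1 ≤ k → k ≤ N → φ (jacobiPoly s β k) = 0) :
    φ (Polynomial.X * (testPoly s β σ (L + 1) * testPoly s β σ (L + 1))) =
      s * (L + 1) + 2 * σ * (L * √γ) := by
  have hn : ∀ k ≤ L + 1, 0 < jacobiNorm β k := by
    intro k hk
    induction k with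
    | zero => simp [jacobiNorm]
    | succ k ih => exact mul_pos (hpos k (by omega)) (ih (by omega))
  have h := jacobiPoly_X_mul_mul s β φ N h0 hφ
  set w : ℕ → ℝ := fun k => σ ^ k / √(jacobiNorm β (k + 1)) with hw
  have hdiag : ∀ k < L + 1, w k * w k * jacobiNorm β (k + 1) = 1 := by
    intro k hk
    have hp := hn (k + 1) (by omega)
    rw [hw]
    simp only
    rw [div_mul_div_comm, Real.mul_self_sqrt hp.le, ← mul_pow, ← sq, hσ, one_pow,
      one_div_mul_cancel hp.ne']
  have hoff : ∀ k < L, w k * w (k + 1) * jacobiNorm β (k + 2) = σ * √γ := by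
    intro k hk
    have hp := hn (k + 1) (by omega)
    have hg : 0 < γ := by rw [← hγ k]; exact hpos _ (by omega)
    have e : jacobiNorm β (k + 2) = γ * jacobiNorm β (k + 1) := by rw [← hγ k]; rfl
    have hs := (Real.sqrt_pos.2 hp).ne'
    have hs' := (Real.sqrt_pos.2 hg).ne'
    have hσk : σ ^ k * σ ^ (k + 1) = σ := by
      rw [← pow_add, show k + (k + 1) = 2 * k + 1 by ring, pow_succ, pow_mul, hσ]; simp
    have e2 : γ * jacobiNorm β (k + 1) = √γ * √γ * (√(jacobiNorm β (k + 1)) * √(jacobiNorm β (k + 1))) := by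
      rw [Real.mul_self_sqrt hp.le, Real.mul_self_sqrt hg.le]
    rw [hw]
    simp only
    rw [div_mul_div_comm, hσk, show k + 1 + 1 = k + 2 by ring, e, Real.sqrt_mul hg.le, e2]
    field_simp
  have key : φ (Polynomial.X * (testPoly s β σ (L + 1) * testPoly s β σ (L + 1))) =
      ∑ k ∈ Finset.range (L + 1), ∑ l ∈ Finset.range (L + 1), w k * w l *
      ((if k = l then s * jacobiNorm β (k + 1) else 0)
      + (if k + 1 = l then jacobiNorm β (l + 1) else 0)
      + (if l + 1 = k then jacobiNorm β (k + 1) else 0)) := by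
    rw [testPoly, Finset.sum_mul_sum, Finset.mul_sum, map_sum]
    refine Finset.sum_congr rfl fun k hk => ?_
    rw [Finset.mul_sum, map_sum]
    refine Finset.sum_congr rfl fun l hl => ?_
    have := Finset.mem_range.1 hk
    have := Finset.mem_range.1 hl
    rw [smul_mul_smul_comm, mul_smul_comm, map_smul, h k l (by omega), smul_eq_mul]
  have up : ∀ F : ℕ → ℕ → ℝ, (∀ k < L, F k (k + 1) = σ * √γ) →
      ∑ k ∈ Finset.range (L + 1), ∑ l ∈ Finset.range (L + 1),
        (if k + 1 = l then F k l else 0) = σ * (L * √γ) := by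
    intro F hF
    have : ∀ k ∈ Finset.range (L + 1), ∑ l ∈ Finset.range (L + 1),
        (if k + 1 = l then F k l else 0) = if k < L then σ * √γ else 0 := by
      intro k hk
      rw [Finset.sum_ite_eq]
      by_cases hkL : k < L
      · simp [hkL, hF k hkL]
      · simp [hkL]
    rw [Finset.sum_congr rfl this, Finset.sum_range_succ, if_neg (lt_irrefl L), add_zero,
      Finset.sum_congr rfl (fun k hk => if_pos (Finset.mem_range.1 hk))]
    simp
    ring
  rw [key]
  simp only [mul_add, mul_ite, mul_zero, Finset.sum_add_distrib]
  have e1 : ∑ k ∈ Finset.range (L + 1), ∑ l ∈ Finset.range (L + 1),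
      (if k = l then w k * w l * (s * jacobiNorm β (k + 1)) else 0) = s * (L + 1) := by
    have : ∀ k ∈ Finset.range (L + 1), ∑ l ∈ Finset.range (L + 1),
        (if k = l then w k * w l * (s * jacobiNorm β (k + 1)) else 0) = s := by
      intro k hk
      rw [Finset.sum_ite_eq, if_pos hk]
      linear_combination s * hdiag k (Finset.mem_range.1 hk)
    rw [Finset.sum_congr rfl this]
    simp
    ring
  have e2 := up (fun k l => w k * w l * jacobiNorm β (l + 1)) hoff
  have e3 := up (fun l k => w k * w l * jacobiNorm β (k + 1))
    (fun k hk => by rw [mul_comm (w (k + 1))]; exact hoff k hk)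
  rw [Finset.sum_comm] at e3
  rw [e1, e2, e3]
  ring

/-! ### Entry bounds and rounding to a feasible matrix. -/

section RowSum

attribute [local instance] Matrix.linftyOpNormedRing Matrix.linftyOpNormedAlgebra
  Matrix.linftyOpNormedAddCommGroup Matrix.linftyOpNormedSpace

theorem Matrix.linftyOpNorm_le_of_row_sum_le {V : Type*} [Fintype V]
    (A : Matrix V V ℝ) {R : ℝ} (hR : 0 ≤ R) (hA : ∀ v, ∑ u, |A v u| ≤ R) : ‖A‖ ≤ R := by
  lift R to NNReal using hR
  rw [Matrix.linfty_opNorm_def, NNReal.coe_le_coe]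
  refine Finset.sup_le fun v _ => ?_
  rw [← NNReal.coe_le_coe]
  simpa using hA v

theorem Matrix.abs_apply_le_linftyOpNorm {V : Type*} [Fintype V]
    (A : Matrix V V ℝ) (v w : V) : |A v w| ≤ ‖A‖ := by
  rw [Matrix.linfty_opNorm_def]
  have h := Finset.le_sup (f := fun i => ∑ j, ‖A i j‖₊) (Finset.mem_univ v)
  rw [← NNReal.coe_le_coe] at h
  refine le_trans ?_ h
  push_cast
  exact Finset.single_le_sum (f := fun j => |A v j|) (fun _ _ => abs_nonneg _) (Finset.mem_univ w)

/-- A bound, independent of the size of the matrix, for the entries of a polynomial in a matrix with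
bounded row sums. -/
theorem abs_aeval_apply_le (p : Polynomial ℝ) {V : Type*} [Fintype V] [DecidableEq V] [Nonempty V]
    (A : Matrix V V ℝ) {R : ℝ} (hR : 0 ≤ R) (hA : ∀ v, ∑ u, |A v u| ≤ R) (v w : V) :
    |Polynomial.aeval A p v w| ≤ ∑ i ∈ p.support, |p.coeff i| * R ^ i := by
  refine (Matrix.abs_apply_le_linftyOpNorm _ v w).trans ?_
  rw [Polynomial.aeval_eq_sum_range' (Nat.lt_succ_self p.natDegree)]
  have hs : ∑ i ∈ Finset.range p.natDegree.succ, p.coeff i • A ^ i =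
      ∑ i ∈ p.support, p.coeff i • A ^ i := by
    symm
    refine Finset.sum_subset ?_ ?_
    · intro i hi
      exact Finset.mem_range_succ_iff.2 (Polynomial.le_natDegree_of_mem_supp i hi)
    · intro i _ hi
      rw [Polynomial.notMem_support_iff.1 hi, zero_smul]
  rw [hs]
  refine (norm_sum_le _ _).trans (Finset.sum_le_sum fun i _ => ?_)
  rw [norm_smul, Real.norm_eq_abs]
  refine mul_le_mul_of_nonneg_left ?_ (abs_nonneg _)
  have hAn := Matrix.linftyOpNorm_le_of_row_sum_le A hR hA
  rcases Nat.eq_zero_or_pos i with rfl | hi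
  · simp
  · exact (norm_pow_le' A hi).trans (pow_le_pow_left₀ (norm_nonneg _) hAn i)

end RowSum

/-- Rounding the square of a symmetric matrix that has constant diagonal on `good` to a feasible
matrix, with a loss proportional to the number of the other vertices. -/
theorem exists_isSDPFeasible_of_good {V : Type*} [Fintype V] [DecidableEq V]
    (A Q : Matrix V V ℝ) (hQ : Q.IsSymm) (hA : A.IsSymm) (hdiag : ∀ v, A v v = 0)
    (good : Finset V) {a τ R D : ℝ} (ha : 0 < a)
    (h1 : ∀ v ∈ good, (Q * Q) v v = a) (h2 : ∀ v ∈ good, (A * (Q * Q)) v v = τ)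
    (hRA : ∀ v, ∑ u, |A v u| ≤ R) (hD : ∀ v w, |(Q * Q) v w| ≤ D) :
    ∃ M : Matrix V V ℝ, IsSDPFeasible M ∧
      |matInner A M - good.card * (τ / a)| ≤ goodᶜ.card * (R * D / a) := by
  classical
  set G : Matrix V V ℝ := Matrix.diagonal fun v => if v ∈ good then 1 else 0 with hG
  have hsymm : (Q * Q).IsSymm := by
    rw [Matrix.IsSymm, Matrix.transpose_mul, hQ.eq]
  set M : Matrix V V ℝ := (a⁻¹ • (G * (Q * Q) * G)) +
    Matrix.diagonal fun v => if v ∈ good then 0 else 1 with hM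
  have hMapp : ∀ v w, M v w = a⁻¹ * ((if v ∈ good then 1 else 0) * (Q * Q) v w *
      (if w ∈ good then 1 else 0)) + if v = w then (if v ∈ good then 0 else 1) else 0 := by
    intro v w
    rw [hM, Matrix.add_apply, Matrix.smul_apply, hG, Matrix.mul_diagonal, Matrix.diagonal_mul,
      Matrix.diagonal_apply, smul_eq_mul]
  refine ⟨M, ⟨?_, ?_⟩, ?_⟩
  · refine Matrix.PosSemidef.add ?_ ?_
    · refine Matrix.PosSemidef.smul ?_ (inv_nonneg.2 ha.le)
      have : G * (Q * Q) * G = (Q * G).conjTranspose * (Q * G) := by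
        rw [Matrix.conjTranspose_eq_transpose_of_trivial, Matrix.transpose_mul, hQ.eq, hG,
          Matrix.diagonal_transpose]
        simp only [Matrix.mul_assoc]
      rw [this]
      exact Matrix.posSemidef_conjTranspose_mul_self _
    · refine Matrix.PosSemidef.diagonal fun v => ?_
      simp only [Pi.zero_apply]
      split_ifs <;> norm_num
  · intro v
    rw [hMapp]
    by_cases hv : v ∈ good
    · simp [hv, h1 v hv, ha.ne']
    · simp [hv]
  -- The identity placed on the bad vertices pairs to zero, since `A` has zero diagonal.
  · have hin : matInner A M = a⁻¹ * ∑ v ∈ good, ∑ w ∈ good, A v w * (Q * Q) v w := by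
      have : ∀ v w, A v w * M v w = if v ∈ good then (if w ∈ good then
          a⁻¹ * (A v w * (Q * Q) v w) else 0) else 0 := by
        intro v w
        rw [hMapp]
        by_cases hvw : v = w
        · subst hvw
          simp [hdiag]
        · by_cases hv : v ∈ good <;> by_cases hw : w ∈ good <;> simp [hv, hw, hvw]
          ring
      simp only [matInner, this]
      rw [Finset.mul_sum, ← Finset.sum_filter_add_sum_filter_not Finset.univ (· ∈ good)]
      simp only [Finset.mul_sum]
      rw [Finset.sum_congr (g := fun v => ∑ w ∈ good, a⁻¹ * (A v w * (Q * Q) v w))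
        (Finset.filter_univ_mem good) fun v hv => ?_]
      · rw [Finset.sum_eq_zero (s := Finset.filter _ _), add_zero]
        intro v hv
        simp [(Finset.mem_filter.1 hv).2]
      · simp [hv]
    have hfull : ∑ v ∈ good, ∑ w, A v w * (Q * Q) v w = good.card * τ := by
      rw [Finset.sum_congr rfl fun v hv => ?_, Finset.sum_const, nsmul_eq_mul]
      rw [← h2 v hv, Matrix.mul_apply]
      exact Finset.sum_congr rfl fun w _ => by rw [hsymm.apply]
    have hsplit : ∑ v ∈ good, ∑ w, A v w * (Q * Q) v w =
        (∑ v ∈ good, ∑ w ∈ good, A v w * (Q * Q) v w) +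
        ∑ v ∈ good, ∑ w ∈ goodᶜ, A v w * (Q * Q) v w := by
      rw [← Finset.sum_add_distrib]
      exact Finset.sum_congr rfl fun v _ => (Finset.sum_add_sum_compl good _).symm
    have hbad : |∑ v ∈ good, ∑ w ∈ goodᶜ, A v w * (Q * Q) v w| ≤ goodᶜ.card * (R * D) := by
      -- Grouping the lost entries by their bad endpoint `w`, each `w` costs at most one row sum of
      -- `A` times the entry bound `D`.
      rw [Finset.sum_comm]
      refine (Finset.abs_sum_le_sum_abs _ _).trans ?_
      rw [← nsmul_eq_mul]
      refine Finset.sum_le_card_nsmul _ _ _ fun w _ => ?_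
      have hD0 : 0 ≤ D := (abs_nonneg _).trans (hD w w)
      refine (Finset.abs_sum_le_sum_abs _ _).trans ?_
      calc ∑ v ∈ good, |A v w * (Q * Q) v w| ≤ ∑ v, |A w v| * D := by
            refine (Finset.sum_le_univ_sum_of_nonneg fun _ => abs_nonneg _).trans ?_
            refine Finset.sum_le_sum fun v _ => ?_
            rw [abs_mul, hA.apply]
            exact mul_le_mul_of_nonneg_left (hD v w) (abs_nonneg _)
        _ ≤ R * D := by
            rw [← Finset.sum_mul]
            exact mul_le_mul_of_nonneg_right (hRA w) hD0
    have : matInner A M - good.card * (τ / a) =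
        -(a⁻¹ * ∑ v ∈ good, ∑ w ∈ goodᶜ, A v w * (Q * Q) v w) := by
      rw [hin]
      linear_combination a⁻¹ * hfull - a⁻¹ * hsplit
    rw [this, abs_neg, abs_mul, abs_of_pos (inv_pos.2 ha)]
    calc a⁻¹ * _ ≤ a⁻¹ * (goodᶜ.card * (R * D)) :=
          mul_le_mul_of_nonneg_left hbad (inv_pos.2 ha).le
      _ = _ := by ring

theorem Matrix.IsSymm.aeval {V : Type*} [Fintype V] [DecidableEq V] {A : Matrix V V ℝ}
    (hA : A.IsSymm) (p : Polynomial ℝ) : (Polynomial.aeval A p).IsSymm := by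
  rw [Matrix.IsSymm, Polynomial.aeval_eq_sum_range, Matrix.transpose_sum]
  refine Finset.sum_congr rfl fun i _ => ?_
  rw [Matrix.transpose_smul, Matrix.transpose_pow, hA.eq]

/-- The diagonal entry at `v` of a polynomial in the matrix `A`, as a functional. -/
noncomputable def diagFunctional {V : Type*} [Fintype V] [DecidableEq V] (A : Matrix V V ℝ)
    (v : V) : Polynomial ℝ →ₗ[ℝ] ℝ :=
  (Matrix.entryLinearMap ℝ ℝ v v).comp (Polynomial.aeval A).toLinearMap

@[simp]
theorem diagFunctional_apply {V : Type*} [Fintype V] [DecidableEq V] (A : Matrix V V ℝ)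
    (v : V) (p : Polynomial ℝ) : diagFunctional A v p = Polynomial.aeval A p v v := rfl

/-- If the polynomials `jacobiPoly s β k` of `A` have vanishing diagonal at most vertices, then
there is a feasible matrix with value close to `s + 2 σ √γ`. -/
theorem exists_isSDPFeasible_of_jacobi {V : Type*} [Fintype V] [DecidableEq V] [Nonempty V]
    (A : Matrix V V ℝ) (hA : A.IsSymm) (hdiag : ∀ v, A v v = 0) {R : ℝ} (hR : 0 ≤ R)
    (hRA : ∀ v, ∑ u, |A v u| ≤ R)
    (s : ℝ) (β : ℕ → ℝ) (γ : ℝ) (hγ : ∀ k, β (k + 1) = γ)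
    (σ : ℝ) (hσ : σ ^ 2 = 1) (L : ℕ) (hpos : ∀ k < L + 1, 0 < β k) (good : Finset V)
    (hgood : ∀ v ∈ good, ∀ k, 1 ≤ k → k ≤ 2 * L + 3 →
      Polynomial.aeval A (jacobiPoly s β k) v v = 0) :
    ∃ M : Matrix V V ℝ, IsSDPFeasible M ∧
      |matInner A M - good.card * (s + 2 * σ * (L / (L + 1) * √γ))| ≤
        goodᶜ.card * (R * (∑ i ∈ (testPoly s β σ (L + 1) * testPoly s β σ (L + 1)).support,
          |(testPoly s β σ (L + 1) * testPoly s β σ (L + 1)).coeff i| * R ^ i) / (L + 1)) := by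
  set q := testPoly s β σ (L + 1) with hq
  have hL : (0 : ℝ) < L + 1 := by positivity
  have hone : ∀ v, diagFunctional A v 1 = 1 := fun v => by simp
  obtain ⟨M, hM, hb⟩ := exists_isSDPFeasible_of_good A (Polynomial.aeval A q) (hA.aeval q) hA hdiag
    good (a := L + 1) (τ := s * (L + 1) + 2 * σ * (L * √γ)) (R := R) hL
    (fun v hv => by
      have := apply_testPoly_sq s β σ hσ (L + 1) hpos (diagFunctional A v) (2 * L + 3) (by omega)
        (hone v) (fun k h1 h2 => hgood v hv k h1 h2)
      rw [← map_mul]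
      simpa using this)
    (fun v hv => by
      have := apply_X_mul_testPoly_sq s β γ hγ σ hσ L hpos (diagFunctional A v) (2 * L + 3)
        (by omega) (hone v) (fun k h1 h2 => hgood v hv k h1 h2)
      rw [diagFunctional_apply, map_mul, Polynomial.aeval_X] at this
      rw [← map_mul]
      exact this)
    hRA (fun v w => by rw [← map_mul]; exact abs_aeval_apply_le (q * q) A hR hRA v w)
  refine ⟨M, hM, ?_⟩
  convert hb using 3
  field_simp

/-! ### Nonbacktracking sums as polynomials in the sum of the blocks. -/

/-- The sum of the products `B f₀ * B f₁ * ⋯ * B fₖ` over the sequences with `f₀ = f` and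
`fₜ ≠ fₜ₊₁` for all `t`. -/
def nonbacktrackingSum {F R : Type*} [Fintype F] [DecidableEq F] [Ring R] (B : F → R) :
    ℕ → F → R
  | 0, f => B f
  | k + 1, f => B f * ∑ g ∈ Finset.univ.erase f, nonbacktrackingSum B k g

theorem nonbacktrackingSum_succ {F R : Type*} [Fintype F] [DecidableEq F] [Ring R] (B : F → R)
    (k : ℕ) (f : F) : nonbacktrackingSum B (k + 1) f =
      B f * ((∑ g, nonbacktrackingSum B k g) - nonbacktrackingSum B k f) := by
  rw [nonbacktrackingSum, ← Finset.add_sum_erase _ _ (Finset.mem_univ f), add_sub_cancel_left]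

/-- The Jacobi coefficients of an additive lift of `c` atoms with eigenvalue product `-d`. -/
def liftBeta (d c : ℝ) (k : ℕ) : ℝ := if k = 0 then d * c else d * (c - 1)

/-- Multiply the sum `N k` of all nonbacktracking products by `∑ B f` and remove the terms that
repeat their first factor. The quadratic relation turns these into `s N (k+1) + d ∑ E f (N k - N k
f)`. Here `∑ E f` contributes `c` and the products starting with `f`, which `E f` fixes, take one
away: this is `d(c - 1)`. At the first step `∑ B f² = s ∑ B f + dc` with nothing to subtract, whence
`β 0 = dc`. -/
theorem aeval_jacobiPoly_eq_sum_nonbacktrackingSum {F R : Type*} [Fintype F] [DecidableEq F]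
    [Ring R] [Algebra ℝ R] (B E : F → R) (s d c : ℝ)
    (hB : ∀ f, B f * B f = s • B f + d • E f) (hE : ∀ f, E f * B f = B f)
    (hsum : ∑ f, E f = c • 1) (k : ℕ) :
    Polynomial.aeval (∑ f, B f) (jacobiPoly s (liftBeta d c) (k + 1)) =
      ∑ f, nonbacktrackingSum B k f := by
  have hEN : ∀ k f, E f * nonbacktrackingSum B k f = nonbacktrackingSum B k f := by
    intro k f
    cases k <;> simp only [nonbacktrackingSum, ← mul_assoc, hE]
  induction k using Nat.strong_induction_on with
  | _ k ih =>
  match k with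
  | 0 => simp [jacobiPoly, nonbacktrackingSum]
  | 1 =>
    simp only [nonbacktrackingSum_succ, mul_sub, Finset.sum_sub_distrib, ← Finset.sum_mul]
    simp only [nonbacktrackingSum, hB, Finset.sum_add_distrib, ← Finset.smul_sum, hsum]
    simp [jacobiPoly, liftBeta, sub_mul, Algebra.algebraMap_eq_smul_one, sub_sub]
    rw [smul_comm]
  | k + 2 =>
    have h1 := ih (k + 1) (by omega)
    have h0 := ih k (by omega)
    rw [jacobiPoly, map_sub, map_mul, map_mul, map_sub, h1, h0, Polynomial.aeval_X,
      Polynomial.aeval_C, Polynomial.aeval_C, Algebra.algebraMap_eq_smul_one,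
      Algebra.algebraMap_eq_smul_one, sub_mul, smul_mul_assoc, smul_mul_assoc, one_mul, one_mul]
    have hstep : ∑ f, nonbacktrackingSum B (k + 1 + 1) f =
        (∑ f, B f) * (∑ f, nonbacktrackingSum B (k + 1) f)
        - ∑ f, B f * nonbacktrackingSum B (k + 1) f := by
      simp only [nonbacktrackingSum_succ B (k + 1), mul_sub, Finset.sum_sub_distrib,
        ← Finset.sum_mul]
    have hback : ∀ f, B f * nonbacktrackingSum B (k + 1) f =
        s • nonbacktrackingSum B (k + 1) f +
        d • (E f * (∑ g, nonbacktrackingSum B k g) - nonbacktrackingSum B k f) := by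
      intro f
      rw [nonbacktrackingSum_succ, ← mul_assoc, hB, add_mul, smul_mul_assoc, smul_mul_assoc,
        mul_sub (E f), hEN]
    rw [hstep]
    simp only [hback, Finset.sum_add_distrib, ← Finset.smul_sum, Finset.sum_sub_distrib,
      ← Finset.sum_mul, hsum, liftBeta]
    rw [if_neg (Nat.succ_ne_zero k), smul_mul_assoc, one_mul]
    module

/-! ### Atoms and the blocks of the instance. -/

/-- A real symmetric matrix with the two eigenvalues `l₁`, `l₂` satisfies the corresponding
quadratic equation. -/
theorem Matrix.IsSymm.mul_self_of_spectrum_eq_pair {V : Type*} [Fintype V] [DecidableEq V]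
    {A : Matrix V V ℝ} (hA : A.IsSymm) {l₁ l₂ : ℝ} (h : spectrum ℝ A = {l₁, l₂}) :
    A * A = (l₁ + l₂) • A + (-(l₁ * l₂)) • (1 : Matrix V V ℝ) := by
  have hs : IsSelfAdjoint A := by
    rw [IsSelfAdjoint, Matrix.star_eq_conjTranspose, Matrix.conjTranspose_eq_transpose_of_trivial,
      hA.eq]
  set p : Polynomial ℝ := (Polynomial.X - Polynomial.C l₁) * (Polynomial.X - Polynomial.C l₂)
    with hp
  -- By the functional calculus, a polynomial vanishing on the spectrum kills a self-adjoint matrix.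
  have h0 : Polynomial.aeval A p = 0 := by
    rw [← cfc_polynomial p A hs, ← cfc_zero ℝ A]
    refine cfc_congr fun x hx => ?_
    rw [h] at hx
    rcases hx with rfl | rfl <;> simp [hp]
  rw [hp, map_mul, map_sub, map_sub, Polynomial.aeval_X, Polynomial.aeval_C, Polynomial.aeval_C,
    Algebra.algebraMap_eq_smul_one, Algebra.algebraMap_eq_smul_one, sub_mul, mul_sub, mul_sub,
    smul_mul_smul_comm, smul_mul_assoc, mul_smul_comm, one_mul, mul_one, mul_one] at h0
  rw [← sub_eq_zero, ← h0]
  module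

namespace Atom

/-- As the atom has no loops, the diagonal of its quadratic equation makes `-(l₁ * l₂)` a sum of
squares of a row; if it were zero, the matrix would vanish and have a single eigenvalue. -/
theorem neg_eigenvalue_mul_pos {r : ℕ} (A : Atom r) {l₁ l₂ : ℝ} (hl : l₁ ≠ l₂)
    (h : spectrum ℝ A.adj = {l₁, l₂}) : 0 < -(l₁ * l₂) := by
  have hsq := A.symm.mul_self_of_spectrum_eq_pair h
  have hii : ∀ i, ∑ j, A.adj i j * A.adj i j = -(l₁ * l₂) := by
    intro i
    have := congrFun (congrFun hsq i) i
    rw [Matrix.mul_apply] at this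
    simp only [Matrix.add_apply, Matrix.smul_apply, A.loopless, Matrix.one_apply_eq, smul_eq_mul,
      mul_zero, mul_one, zero_add] at this
    rw [← this]
    exact Finset.sum_congr rfl fun j _ => by rw [A.symm.apply]
  rcases isEmpty_or_nonempty (Fin r) with hr | ⟨⟨i⟩⟩
  · rw [spectrum.of_subsingleton] at h
    exact absurd h (Set.insert_nonempty _ _).ne_empty.symm
  · refine lt_of_le_of_ne ?_ fun h0 => ?_
    · rw [← hii i]
      exact Finset.sum_nonneg fun j _ => mul_self_nonneg _
    · have hz : A.adj = 0 := by
        ext i j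
        have := (Finset.sum_eq_zero_iff_of_nonneg fun j _ => mul_self_nonneg _).1
          ((hii i).trans h0.symm) j (Finset.mem_univ j)
        simpa using this
      have : Nonempty (Fin r) := ⟨i⟩
      rw [hz, spectrum.zero_eq] at h
      have e1 : l₁ ∈ ({0} : Set ℝ) := by rw [h]; simp
      have e2 : l₂ ∈ ({0} : Set ℝ) := by rw [h]; simp
      exact hl (e1.trans e2.symm)

end Atom

namespace ConstraintGraph

variable {r c n : ℕ}

/-- The copy of an atom that the constraint vertex `f` places on its neighbours. -/
def block (K : ConstraintGraph r c n) (A : Fin c → Atom r) (ξ : ConVertex c n → Fin r → ℤˣ)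
    (f : ConVertex c n) : Matrix (VarVertex r n) (VarVertex r n) ℝ :=
  fun v w => if K.Incident v f ∧ K.Incident w f then
    (((ξ f v.1 * ξ f w.1 : ℤˣ) : ℤ) : ℝ) * (A f.1).adj v.1 w.1 else 0

/-- The coordinate projection to the neighbours of the constraint vertex `f`. -/
def blockProj (K : ConstraintGraph r c n) (f : ConVertex c n) :
    Matrix (VarVertex r n) (VarVertex r n) ℝ :=
  Matrix.diagonal fun v => if K.Incident v f then 1 else 0

theorem instanceAdj_eq_sum_block (K : ConstraintGraph r c n) (A : Fin c → Atom r)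
    (ξ : ConVertex c n → Fin r → ℤˣ) : K.instanceAdj A ξ = ∑ f, K.block A ξ f := by
  ext v w
  rw [Matrix.sum_apply]
  rfl

theorem sum_incident (K : ConstraintGraph r c n) (f : ConVertex c n) (g : Fin r → ℝ) :
    ∑ v : VarVertex r n, (if K.Incident v f then g v.1 else 0) = ∑ i, g i := by
  rw [Fintype.sum_prod_type]
  refine Finset.sum_congr rfl fun i _ => ?_
  rw [Finset.sum_eq_single ((K i f.1).symm f.2)]
  · simp [Incident]
  · intro a _ ha
    rw [if_neg]
    intro h
    exact ha (by rw [← show K i f.1 a = f.2 from h, Equiv.symm_apply_apply])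
  · simp

theorem sum_incident_const (K : ConstraintGraph r c n) (v : VarVertex r n) (x : ℝ) :
    ∑ f : ConVertex c n, (if K.Incident v f then x else 0) = c * x := by
  rw [Fintype.sum_prod_type]
  have : ∀ j : Fin c, ∑ b : Fin n, (if K.Incident v (j, b) then x else 0) = x := by
    intro j
    rw [Finset.sum_eq_single (K v.1 j v.2)]
    · simp [Incident]
    · intro b _ hb
      exact if_neg fun h => hb (Eq.symm h)
    · simp
  simp [this]

theorem sum_blockProj (K : ConstraintGraph r c n) :
    ∑ f, K.blockProj f = (c : ℝ) • (1 : Matrix (VarVertex r n) (VarVertex r n) ℝ) := by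
  ext v w
  rw [Matrix.sum_apply, Matrix.smul_apply, Matrix.one_apply]
  by_cases h : v = w
  · subst h
    simp only [blockProj, Matrix.diagonal_apply_eq, if_true, smul_eq_mul]
    exact sum_incident_const K v 1
  · simp [blockProj, h]

theorem blockProj_mul_block (K : ConstraintGraph r c n) (A : Fin c → Atom r)
    (ξ : ConVertex c n → Fin r → ℤˣ) (f : ConVertex c n) :
    K.blockProj f * K.block A ξ f = K.block A ξ f := by
  ext v w
  rw [blockProj, Matrix.diagonal_mul, block]
  by_cases h : K.Incident v f <;> simp [h]

theorem eq_of_incident {K : ConstraintGraph r c n} {v w : VarVertex r n} {f : ConVertex c n}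
    (hv : K.Incident v f) (hw : K.Incident w f) (h : v.1 = w.1) : v = w := by
  obtain ⟨i, a⟩ := v
  obtain ⟨i', a'⟩ := w
  obtain rfl : i = i' := h
  rw [(K i f.1).injective (show K i f.1 a = K i f.1 a' from Eq.trans hv (Eq.symm hw))]

/-- The constraint vertex has exactly one neighbour in each group, so its block is a copy of the
atom conjugated by a diagonal sign matrix, which preserves the quadratic equation. -/
theorem block_mul_self (K : ConstraintGraph r c n) (A : Fin c → Atom r) {l₁ l₂ : ℝ}
    (hA : ∀ j, spectrum ℝ (A j).adj = {l₁, l₂}) (ξ : ConVertex c n → Fin r → ℤˣ)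
    (f : ConVertex c n) :
    K.block A ξ f * K.block A ξ f =
      (l₁ + l₂) • K.block A ξ f + (-(l₁ * l₂)) • K.blockProj f := by
  ext v w
  rw [Matrix.mul_apply, Matrix.add_apply, Matrix.smul_apply, Matrix.smul_apply, blockProj,
    Matrix.diagonal_apply]
  by_cases hv : K.Incident v f
  swap
  · simp [block, hv]
  by_cases hw : K.Incident w f
  swap
  · have hne : v ≠ w := fun h => hw (h ▸ hv)
    simp [block, hw, hne]
  have hu : ∀ u : VarVertex r n, K.block A ξ f v u * K.block A ξ f u w =
      if K.Incident u f then (((ξ f v.1 * ξ f w.1 : ℤˣ) : ℤ) : ℝ) *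
        ((A f.1).adj v.1 u.1 * (A f.1).adj u.1 w.1) else 0 := by
    intro u
    by_cases hu : K.Incident u f
    · have hsq : (((ξ f u.1 : ℤˣ) : ℤ) : ℝ) * (((ξ f u.1 : ℤˣ) : ℤ) : ℝ) = 1 := by
        rw [← Int.cast_mul, ← Units.val_mul, Int.units_mul_self]
        simp
      simp only [block, hv, hw, hu, and_self, if_true, Units.val_mul, Int.cast_mul]
      linear_combination ((((ξ f v.1 : ℤˣ) : ℤ) : ℝ) * (((ξ f w.1 : ℤˣ) : ℤ) : ℝ) *
        ((A f.1).adj v.1 u.1 * (A f.1).adj u.1 w.1)) * hsq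
    · simp [block, hu]
  rw [Finset.sum_congr rfl fun u _ => hu u, sum_incident K f (fun i =>
    (((ξ f v.1 * ξ f w.1 : ℤˣ) : ℤ) : ℝ) * ((A f.1).adj v.1 i * (A f.1).adj i w.1)),
    ← Finset.mul_sum, ← Matrix.mul_apply, (A f.1).symm.mul_self_of_spectrum_eq_pair (hA f.1),
    Matrix.add_apply, Matrix.smul_apply, Matrix.smul_apply, Matrix.one_apply]
  simp only [block, hv, hw, and_self, if_true]
  by_cases h : v = w
  · subst h
    rw [Int.units_mul_self]
    simp [(A f.1).loopless]
  · have h' : v.1 ≠ w.1 := fun h' => h (eq_of_incident hv hw h')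
    simp only [h, h', if_false, smul_eq_mul]
    ring

theorem instanceAdj_isSymm (K : ConstraintGraph r c n) (A : Fin c → Atom r)
    (ξ : ConVertex c n → Fin r → ℤˣ) : (K.instanceAdj A ξ).IsSymm := by
  refine Matrix.IsSymm.ext fun v w => Finset.sum_congr rfl fun f _ => ?_
  rw [(A f.1).symm.apply, mul_comm (ξ f w.1)]
  exact if_congr and_comm rfl rfl

theorem instanceAdj_self (K : ConstraintGraph r c n) (A : Fin c → Atom r)
    (ξ : ConVertex c n → Fin r → ℤˣ) (v : VarVertex r n) : K.instanceAdj A ξ v v = 0 :=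
  Finset.sum_eq_zero fun f _ => by simp [(A f.1).loopless]

theorem sum_abs_instanceAdj_le (K : ConstraintGraph r c n) (A : Fin c → Atom r)
    (ξ : ConVertex c n → Fin r → ℤˣ) (v : VarVertex r n) :
    ∑ w, |K.instanceAdj A ξ v w| ≤ c * r := by
  calc ∑ w, |K.instanceAdj A ξ v w|
      ≤ ∑ w, ∑ f : ConVertex c n, if K.Incident v f then (if K.Incident w f then (1 : ℝ) else 0)
          else 0 := by
        refine Finset.sum_le_sum fun w _ => (Finset.abs_sum_le_sum_abs _ _).trans ?_
        refine Finset.sum_le_sum fun f _ => ?_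
        by_cases hv : K.Incident v f <;> by_cases hw : K.Incident w f <;> simp [hv, hw]
        rcases Int.units_eq_one_or (ξ f v.1) with h1 | h1 <;>
        rcases Int.units_eq_one_or (ξ f w.1) with h2 | h2 <;>
        rcases (A f.1).weight v.1 w.1 with h | h | h <;> simp [h1, h2, h]
    _ = ∑ f : ConVertex c n, if K.Incident v f then (r : ℝ) else 0 := by
        rw [Finset.sum_comm]
        refine Finset.sum_congr rfl fun f _ => ?_
        by_cases hv : K.Incident v f
        · simpa [hv] using sum_incident K f fun _ => 1
        · simp [hv]
    _ = c * r := sum_incident_const K v r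

end ConstraintGraph

/-! ### Reduced words in random permutations. -/

section Words

variable {E α : Type*}

/-- The permutation that a letter (a generator or the inverse of one) stands for. -/
def letterPerm (σ : E → Equiv.Perm α) (l : E × Bool) : Equiv.Perm α :=
  if l.2 then σ l.1 else (σ l.1)⁻¹

/-- The trajectory of the point `a` under the letters `w 0, w 1, …`. -/
def trail (σ : E → Equiv.Perm α) (w : ℕ → E × Bool) (a : α) : ℕ → α
  | 0 => a
  | t + 1 => letterPerm σ (w t) (trail σ w a t)

/-- No letter among the first `m` ones is followed by its inverse. -/
def ReducedUpTo (m : ℕ) (w : ℕ → E × Bool) : Prop :=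
  ∀ t, t + 1 < m → w (t + 1) ≠ ((w t).1, !(w t).2)

theorem ReducedUpTo.mono {m m' : ℕ} {w : ℕ → E × Bool} (h : ReducedUpTo m w) (hm : m' ≤ m) :
    ReducedUpTo m' w := fun t ht => h t (ht.trans_le hm)

theorem trail_congr (σ : E → Equiv.Perm α) {w w' : ℕ → E × Bool} (a : α) {m : ℕ}
    (h : ∀ t < m, w t = w' t) : trail σ w a m = trail σ w' a m := by
  induction m with
  | zero => rfl
  | succ m ih =>
    rw [trail, trail, ih fun t ht => h t (ht.trans m.lt_succ_self), h m m.lt_succ_self]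

theorem letterPerm_inv (σ : E → Equiv.Perm α) (l : E × Bool) :
    letterPerm σ (l.1, !l.2) = (letterPerm σ l)⁻¹ := by
  obtain ⟨e, b⟩ := l
  cases b <;> simp [letterPerm]

variable [DecidableEq E]

/-- Compose the letter `l` with the permutation `τ` after it. -/
def switchLetter (σ : E → Equiv.Perm α) (l : E × Bool) (τ : Equiv.Perm α) : E → Equiv.Perm α :=
  Function.update σ l.1 (if l.2 then τ * σ l.1 else σ l.1 * τ⁻¹)

theorem letterPerm_switchLetter_self (σ : E → Equiv.Perm α) (l : E × Bool) (τ : Equiv.Perm α) :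
    letterPerm (switchLetter σ l τ) l = τ * letterPerm σ l := by
  obtain ⟨e, b⟩ := l
  cases b <;> simp [letterPerm, switchLetter]

theorem letterPerm_switchLetter_inv (σ : E → Equiv.Perm α) (l : E × Bool) (τ : Equiv.Perm α) :
    letterPerm (switchLetter σ l τ) (l.1, !l.2) = letterPerm σ (l.1, !l.2) * τ⁻¹ := by
  obtain ⟨e, b⟩ := l
  cases b <;> simp [letterPerm, switchLetter]

theorem letterPerm_switchLetter_of_ne (σ : E → Equiv.Perm α) {l l' : E × Bool} (h : l'.1 ≠ l.1)
    (τ : Equiv.Perm α) : letterPerm (switchLetter σ l τ) l' = letterPerm σ l' := by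
  simp [letterPerm, switchLetter, h]

theorem switchLetter_switchLetter_inv (σ : E → Equiv.Perm α) (l : E × Bool) (τ : Equiv.Perm α) :
    switchLetter (switchLetter σ l τ) l τ⁻¹ = σ := by
  obtain ⟨e, b⟩ := l
  cases b <;> simp [switchLetter]

variable [DecidableEq α]

/-- Redirecting the step that closes up a trajectory to a new point `y` does not change the
trajectory before that step. -/
theorem trail_switchLetter (σ : E → Equiv.Perm α) (w : ℕ → E × Bool) (a : α) {t s : ℕ}
    (hw : ReducedUpTo (t + 1) w) (hinj : Set.InjOn (trail σ w a) (Set.Iic t))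
    (hclose : trail σ w a (t + 1) = trail σ w a s) {y : α} (hy : ∀ u ≤ t, trail σ w a u ≠ y) :
    ∀ u ≤ t, trail (switchLetter σ (w t) (Equiv.swap (trail σ w a s) y)) w a u =
      trail σ w a u := by
  intro u
  induction u with
  | zero => intro _; rfl
  | succ u ih =>
    intro hu
    rw [trail, ih (by omega), trail]
    by_cases he : (w u).1 = (w t).1
    · by_cases hb : (w u).2 = (w t).2
      · have hwu : w u = w t := Prod.ext he hb
        rw [hwu, letterPerm_switchLetter_self, Equiv.Perm.mul_apply]
        refine Equiv.swap_apply_of_ne_of_ne ?_ ?_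
        -- Same letter as the last step: reaching the closing point already at time `u + 1` would
        -- force `u = t` by injectivity.
        · rw [← hclose]
          intro h
          have h' := (letterPerm σ (w t)).injective h
          have := hinj (Set.mem_Iic.2 (by omega)) (Set.mem_Iic.2 le_rfl) h'
          omega
        · have := hy (u + 1) hu
          rwa [trail, hwu] at this
      · have hwu : w u = ((w t).1, !(w t).2) := by
          refine Prod.ext he ?_
          cases h1 : (w u).2 <;> cases h2 : (w t).2 <;> simp_all
        rw [hwu, letterPerm_switchLetter_inv, Equiv.Perm.mul_apply, Equiv.swap_inv,
          Equiv.swap_apply_of_ne_of_ne _ (hy u (by omega))]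
        -- Inverse letter: leaving from the closing point would lead to the position at time `t`, so
        -- `u + 1 = t` and the last two letters would cancel.
        rw [← hclose]
        intro h
        have h' : trail σ w a (u + 1) = trail σ w a t := by
          rw [trail, hwu, letterPerm_inv, h, trail, Equiv.Perm.inv_def,
            Equiv.symm_apply_apply]
        have hut : u + 1 = t := hinj (Set.mem_Iic.2 hu) (Set.mem_Iic.2 le_rfl) h'
        have := hw u (by omega)
        rw [hut, hwu] at this
        simp at this
    · rw [letterPerm_switchLetter_of_ne _ he]

variable [Fintype E] [Fintype α]

-- Switching: redirect the closing step to any of the at least `card α - (t + 1)` points `y` off the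
-- trajectory. The result determines the pair `(σ, y)`: `y` is its position at time `t + 1`, the old
-- closing point lies on the unchanged initial part, and the swap can then be undone.
open Classical in
theorem card_close_mul_le (w : ℕ → E × Bool) (a : α) {t s : ℕ} (hs : s ≤ t)
    (hw : ReducedUpTo (t + 1) w) :
    (Finset.univ.filter fun σ : E → Equiv.Perm α => Set.InjOn (trail σ w a) (Set.Iic t) ∧
      trail σ w a (t + 1) = trail σ w a s).card * (Fintype.card α - (t + 1)) ≤
      Fintype.card (E → Equiv.Perm α) := by
  set S := Finset.univ.filter fun σ : E → Equiv.Perm α => Set.InjOn (trail σ w a) (Set.Iic t) ∧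
      trail σ w a (t + 1) = trail σ w a s with hS
  set Y : (E → Equiv.Perm α) → Finset α := fun σ =>
    ((Finset.range (t + 1)).image (trail σ w a))ᶜ with hY
  have hcardY : ∀ σ, Fintype.card α - (t + 1) ≤ (Y σ).card := by
    intro σ
    rw [hY, Finset.card_compl]
    exact Nat.sub_le_sub_left (Finset.card_image_le.trans_eq (Finset.card_range _)) _
  have hmemY : ∀ σ y, y ∈ Y σ → ∀ u ≤ t, trail σ w a u ≠ y := by
    intro σ y hy u hu h
    refine Finset.mem_compl.1 hy (Finset.mem_image.2 ⟨u, Finset.mem_range.2 (by omega), h⟩)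
  calc S.card * (Fintype.card α - (t + 1)) ≤ ∑ σ ∈ S, (Y σ).card := by
        rw [← smul_eq_mul]
        exact Finset.card_nsmul_le_sum _ _ _ fun σ _ => hcardY σ
    _ = (S.sigma Y).card := (Finset.card_sigma _ _).symm
    _ ≤ (Finset.univ : Finset (E → Equiv.Perm α)).card := by
        refine Finset.card_le_card_of_injOn
          (fun p => switchLetter p.1 (w t) (Equiv.swap (trail p.1 w a s) p.2))
          (fun _ _ => Finset.mem_coe.2 (Finset.mem_univ _)) ?_
        have hfix : ∀ p ∈ S.sigma Y, ∀ u ≤ t,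
            trail (switchLetter p.1 (w t) (Equiv.swap (trail p.1 w a s) p.2)) w a u =
              trail p.1 w a u := by
          intro p hp
          obtain ⟨h1, h2⟩ := Finset.mem_sigma.1 hp
          obtain ⟨_, h3, h4⟩ := Finset.mem_filter.1 h1
          exact trail_switchLetter p.1 w a hw h3 h4 (hmemY _ _ h2)
        have hlast : ∀ p ∈ S.sigma Y,
            trail (switchLetter p.1 (w t) (Equiv.swap (trail p.1 w a s) p.2)) w a (t + 1) =
              p.2 := by
          intro p hp
          have h4 := (Finset.mem_filter.1 (Finset.mem_sigma.1 hp).1).2.2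
          rw [trail, hfix p hp t le_rfl, letterPerm_switchLetter_self, Equiv.Perm.mul_apply]
          rw [trail] at h4
          rw [h4, Equiv.swap_apply_left]
        intro p hp p' hp' h
        have h : switchLetter p.1 (w t) (Equiv.swap (trail p.1 w a s) p.2) =
          switchLetter p'.1 (w t) (Equiv.swap (trail p'.1 w a s) p'.2) := h
        have e2 : p.2 = p'.2 := by
          rw [← hlast p hp, ← hlast p' hp', h]
        have es : trail p.1 w a s = trail p'.1 w a s := by
          rw [← hfix p hp s hs, ← hfix p' hp' s hs, h]
        have e1 : p.1 = p'.1 := by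
          rw [← switchLetter_switchLetter_inv p.1 (w t) (Equiv.swap (trail p.1 w a s) p.2), h, es,
            e2, switchLetter_switchLetter_inv]
        exact Sigma.ext e1 (heq_of_eq e2)
    _ = _ := Finset.card_univ

-- Union bound over the first time at which the trajectory meets itself and over the earlier
-- position it hits. The truncated subtraction makes the bound trivial when `m` exceeds the number
-- of points.
open Classical in
theorem card_not_injOn_mul_le (w : ℕ → E × Bool) (a : α) {m : ℕ} (hw : ReducedUpTo m w)
    (t : ℕ) (ht : t ≤ m) :
    (Finset.univ.filter fun σ : E → Equiv.Perm α =>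
      ¬ Set.InjOn (trail σ w a) (Set.Iic t)).card * (Fintype.card α - m) ≤
      t * (m * Fintype.card (E → Equiv.Perm α)) := by
  induction t with
  | zero =>
    rw [Finset.filter_false_of_mem]
    · simp
    · intro σ _
      rw [not_not]
      intro u hu v hv _
      simp only [Set.mem_Iic] at hu hv
      omega
  | succ t ih =>
    set T := Fintype.card (E → Equiv.Perm α)
    set C : ℕ → Finset (E → Equiv.Perm α) := fun s => Finset.univ.filter fun σ =>
      Set.InjOn (trail σ w a) (Set.Iic t) ∧ trail σ w a (t + 1) = trail σ w a s with hC
    have hsub : (Finset.univ.filter fun σ : E → Equiv.Perm α =>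
        ¬ Set.InjOn (trail σ w a) (Set.Iic (t + 1))) ⊆
        (Finset.univ.filter fun σ : E → Equiv.Perm α =>
          ¬ Set.InjOn (trail σ w a) (Set.Iic t)) ∪ (Finset.range (t + 1)).biUnion C := by
      intro σ hσ
      have hσ := (Finset.mem_filter.1 hσ).2
      rw [Finset.mem_union]
      by_cases hinj : Set.InjOn (trail σ w a) (Set.Iic t)
      · right
        have hex : ∃ s ≤ t, trail σ w a (t + 1) = trail σ w a s := by
          by_contra! hne
          refine hσ fun u hu v hv huv => ?_
          simp only [Set.mem_Iic] at hu hv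
          rcases Nat.lt_or_ge t u with h1 | h1 <;> rcases Nat.lt_or_ge t v with h2 | h2
          · omega
          · obtain rfl : u = t + 1 := by omega
            exact absurd huv (hne v h2)
          · obtain rfl : v = t + 1 := by omega
            exact absurd huv.symm (hne u h1)
          · exact hinj h1 h2 huv
        obtain ⟨s, hs, hst⟩ := hex
        exact Finset.mem_biUnion.2 ⟨s, Finset.mem_range.2 (by omega),
          Finset.mem_filter.2 ⟨Finset.mem_univ _, hinj, hst⟩⟩
      · left
        exact Finset.mem_filter.2 ⟨Finset.mem_univ _, hinj⟩
    have hCs : ∀ s ∈ Finset.range (t + 1), (C s).card * (Fintype.card α - m) ≤ T := by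
      intro s hs
      have hs := Finset.mem_range.1 hs
      refine le_trans (Nat.mul_le_mul_left _ ?_)
        (card_close_mul_le w a (by omega : s ≤ t) (hw.mono ht))
      omega
    calc _ ≤ ((Finset.univ.filter fun σ : E → Equiv.Perm α =>
          ¬ Set.InjOn (trail σ w a) (Set.Iic t)).card +
          ∑ s ∈ Finset.range (t + 1), (C s).card) * (Fintype.card α - m) := by
          refine Nat.mul_le_mul_right _ ((Finset.card_le_card hsub).trans ?_)
          exact (Finset.card_union_le _ _).trans (Nat.add_le_add_left Finset.card_biUnion_le _)
      _ ≤ t * (m * T) + (t + 1) * T := by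
          rw [add_mul, Finset.sum_mul]
          refine Nat.add_le_add (ih (by omega)) ?_
          refine (Finset.sum_le_card_nsmul _ _ _ hCs).trans ?_
          rw [Finset.card_range, smul_eq_mul]
      _ ≤ (t + 1) * (m * T) := by
          have := Nat.mul_le_mul_right T ht
          linarith

open Classical in
/-- A fixed point of a random nontrivial reduced word is unlikely. -/
theorem card_trail_eq_mul_le (w : ℕ → E × Bool) (a : α) {m : ℕ} (hm : 0 < m)
    (hw : ReducedUpTo m w) :
    (Finset.univ.filter fun σ : E → Equiv.Perm α => trail σ w a m = a).card *
      (Fintype.card α - m) ≤ m * (m * Fintype.card (E → Equiv.Perm α)) := by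
  refine le_trans (Nat.mul_le_mul_right _ (Finset.card_le_card ?_))
    (card_not_injOn_mul_le w a hw m le_rfl)
  intro σ hσ
  have hσ := (Finset.mem_filter.1 hσ).2
  refine Finset.mem_filter.2 ⟨Finset.mem_univ _, fun h => ?_⟩
  have := h (Set.mem_Iic.2 le_rfl) (Set.mem_Iic.2 (Nat.zero_le m)) hσ
  omega

open Classical in
theorem card_exists_trail_eq_mul_le (a : α) {m : ℕ} (hm : 0 < m) :
    (Finset.univ.filter fun σ : E → Equiv.Perm α =>
      ∃ w : ℕ → E × Bool, ReducedUpTo m w ∧ trail σ w a m = a).card * (Fintype.card α - m) ≤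
      Fintype.card (Fin m → E × Bool) * (m * (m * Fintype.card (E → Equiv.Perm α))) := by
  have : NeZero m := ⟨hm.ne'⟩
  -- Periodic extension of a finite word; only its first `m` letters matter, which leaves finitely
  -- many words for the union bound.
  set ext : (Fin m → E × Bool) → ℕ → E × Bool := fun p t => p (Fin.ofNat m t) with hext
  set P := Finset.univ.filter fun p : Fin m → E × Bool => ReducedUpTo m (ext p)
  have hsub : (Finset.univ.filter fun σ : E → Equiv.Perm α =>
      ∃ w : ℕ → E × Bool, ReducedUpTo m w ∧ trail σ w a m = a) ⊆
      P.biUnion fun p => Finset.univ.filter fun σ => trail σ (ext p) a m = a := by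
    intro σ hσ
    obtain ⟨w, hw, hwa⟩ := (Finset.mem_filter.1 hσ).2
    have he : ∀ t < m, ext (fun i => w i) t = w t := by
      intro t ht
      simp [hext, Nat.mod_eq_of_lt ht]
    refine Finset.mem_biUnion.2 ⟨fun i => w i, Finset.mem_filter.2 ⟨Finset.mem_univ _, ?_⟩,
      Finset.mem_filter.2 ⟨Finset.mem_univ _, ?_⟩⟩
    · intro t ht
      rw [he _ ht, he t (by omega)]
      exact hw t ht
    · rw [trail_congr σ a he, hwa]
  refine (Nat.mul_le_mul_right _ ((Finset.card_le_card hsub).trans Finset.card_biUnion_le)).trans ?_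
  rw [Finset.sum_mul]
  refine (Finset.sum_le_card_nsmul _ _ _ fun p hp =>
    card_trail_eq_mul_le (ext p) a hm (Finset.mem_filter.1 hp).2).trans ?_
  rw [smul_eq_mul]
  exact Nat.mul_le_mul_right _ (Finset.card_le_univ P)

end Words

/-! ### From nonbacktracking walks to reduced words, and the count of bad vertices. -/

/-- The word `l₀ l₁ w 0 w 1 …`. -/
def prependTwo {β : Type*} (l₀ l₁ : β) (w : ℕ → β) : ℕ → β
  | 0 => l₀
  | 1 => l₁
  | t + 2 => w t

theorem trail_prependTwo {E α : Type*} (σ : E → Equiv.Perm α) (l₀ l₁ : E × Bool)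
    (w : ℕ → E × Bool) (a : α) (t : ℕ) : trail σ (prependTwo l₀ l₁ w) a (t + 2) =
      trail σ w (letterPerm σ l₁ (letterPerm σ l₀ a)) t := by
  induction t with
  | zero => rfl
  | succ t ih => rw [trail, ih, trail, prependTwo]

namespace ConstraintGraph

variable {r c n : ℕ}

/-- The permutations of a lift, indexed by the edges of `K_{r,c}`. -/
def edgePerm (K : ConstraintGraph r c n) (e : Fin r × Fin c) : Equiv.Perm (Fin n) := K e.1 e.2

theorem incident_of_block_ne_zero {K : ConstraintGraph r c n} {A : Fin c → Atom r}
    {ξ : ConVertex c n → Fin r → ℤˣ} {f : ConVertex c n} {v w : VarVertex r n}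
    (h : K.block A ξ f v w ≠ 0) : K.Incident v f ∧ K.Incident w f ∧ v.1 ≠ w.1 := by
  rw [block] at h
  by_cases hvw : K.Incident v f ∧ K.Incident w f
  · refine ⟨hvw.1, hvw.2, fun he => h ?_⟩
    simp [he, (A f.1).loopless]
  · exact absurd (if_neg hvw) h

theorem trail_two_of_incident {K : ConstraintGraph r c n} {f : ConVertex c n}
    {v w : VarVertex r n} (hv : K.Incident v f) (hw : K.Incident w f) :
    letterPerm K.edgePerm ((w.1, f.1), false)
      (letterPerm K.edgePerm ((v.1, f.1), true) v.2) = w.2 := by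
  have hv : K v.1 f.1 v.2 = f.2 := hv
  have hw : K w.1 f.1 w.2 = f.2 := hw
  simp only [letterPerm, edgePerm, if_true, Bool.false_eq_true, if_false]
  rw [hv, ← hw, Equiv.Perm.inv_def, Equiv.symm_apply_apply]

/-- A nonzero entry of a nonbacktracking sum comes from a reduced word in the permutations. -/
theorem exists_word_of_nonbacktrackingSum_ne_zero (K : ConstraintGraph r c n) (A : Fin c → Atom r)
    (ξ : ConVertex c n → Fin r → ℤˣ) (k : ℕ) : ∀ (f : ConVertex c n) (v w : VarVertex r n),
    nonbacktrackingSum (K.block A ξ) k f v w ≠ 0 →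
    K.Incident v f ∧ ∃ x : ℕ → (Fin r × Fin c) × Bool, ReducedUpTo (2 * (k + 1)) x ∧
      x 0 = ((v.1, f.1), true) ∧ trail K.edgePerm x v.2 (2 * (k + 1)) = w.2 := by
  induction k with
  | zero =>
    intro f v w h
    obtain ⟨hv, hw, hne⟩ := incident_of_block_ne_zero h
    -- One block is the two-letter word going to `f` and back to the group of `w`; the later letters
    -- are filler. It is reduced because atoms have no loops.
    refine ⟨hv, prependTwo ((v.1, f.1), true) ((w.1, f.1), false) fun _ => ((v.1, f.1), true),
      ?_, rfl, ?_⟩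
    · intro t ht
      obtain rfl : t = 0 := by omega
      simp [prependTwo, hne.symm]
    · exact trail_two_of_incident hv hw
  | succ k ih =>
    intro f v w h
    rw [nonbacktrackingSum, Matrix.mul_apply] at h
    obtain ⟨u, -, hu⟩ := Finset.exists_ne_zero_of_sum_ne_zero h
    obtain ⟨hv, huf, hne⟩ := incident_of_block_ne_zero (left_ne_zero_of_mul hu)
    have h2 := right_ne_zero_of_mul hu
    rw [Matrix.sum_apply] at h2
    obtain ⟨g, hg, hgu⟩ := Finset.exists_ne_zero_of_sum_ne_zero h2
    have hgf : g ≠ f := Finset.ne_of_mem_erase hg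
    obtain ⟨hug, x, hx, hx0, hxt⟩ := ih g u w hgu
    -- A variable vertex has one neighbour in each constraint group, so distinct consecutive
    -- constraint vertices lie in different groups and the letters at `u` cannot cancel.
    have hgf1 : g.1 ≠ f.1 := by
      intro he
      refine hgf (Prod.ext he ?_)
      have e1 : K u.1 g.1 u.2 = g.2 := hug
      have e2 : K u.1 f.1 u.2 = f.2 := huf
      rw [← e1, ← e2, he]
    refine ⟨hv, prependTwo ((v.1, f.1), true) ((u.1, f.1), false) x, ?_, rfl, ?_⟩
    · intro t ht
      rcases t with _ | _ | t
      · simp [prependTwo, hne.symm]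
      · simp [prependTwo, hx0, hgf1]
      · exact hx t (by omega)
    · rw [show 2 * (k + 1 + 1) = 2 * (k + 1) + 2 by ring, trail_prependTwo,
        trail_two_of_incident hv huf, hxt]

/-- The vertices at which a short closed reduced word starts. -/
def IsCyclic (K : ConstraintGraph r c n) (N : ℕ) (v : VarVertex r n) : Prop :=
  ∃ k < N, ∃ x : ℕ → (Fin r × Fin c) × Bool, ReducedUpTo (2 * (k + 1)) x ∧
    trail K.edgePerm x v.2 (2 * (k + 1)) = v.2

/-- A nonzero diagonal entry would come from a nonbacktracking closed walk at `v`, hence from a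
reduced word fixing `v.2`. `IsCyclic` ignores the group coordinate, which can only enlarge the set
of bad vertices. -/
theorem aeval_jacobiPoly_instanceAdj_eq_zero (K : ConstraintGraph r c n) (A : Fin c → Atom r)
    {l₁ l₂ : ℝ} (hA : ∀ j, spectrum ℝ (A j).adj = {l₁, l₂}) (ξ : ConVertex c n → Fin r → ℤˣ)
    {N : ℕ} {v : VarVertex r n} (hv : ¬ K.IsCyclic N v) {k : ℕ} (hk : 1 ≤ k) (hkN : k ≤ N) :
    Polynomial.aeval (K.instanceAdj A ξ)
      (jacobiPoly (l₁ + l₂) (liftBeta (-(l₁ * l₂)) c) k) v v = 0 := by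
  obtain ⟨k, rfl⟩ : ∃ m, k = m + 1 := ⟨k - 1, by omega⟩
  rw [instanceAdj_eq_sum_block, aeval_jacobiPoly_eq_sum_nonbacktrackingSum (K.block A ξ)
    K.blockProj _ _ _ (K.block_mul_self A hA ξ) (K.blockProj_mul_block A ξ) K.sum_blockProj,
    Matrix.sum_apply]
  refine Finset.sum_eq_zero fun f _ => ?_
  by_contra h
  obtain ⟨-, x, hx, -, hxt⟩ := K.exists_word_of_nonbacktrackingSum_ne_zero A ξ k f v v h
  exact hv ⟨k, by omega, x, hx, hxt⟩

-- A fixed vertex is bad in at most a fraction `C / (n - 2N)` of the lifts, by a union bound over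
-- all word lengths `2(k + 1) ≤ 2N`; `C` does not depend on `n`.
open Classical in
theorem card_isCyclic_mul_le (r c N : ℕ) : ∃ C : ℕ, ∀ (n : ℕ) (v : VarVertex r n),
    (Finset.univ.filter fun K : ConstraintGraph r c n => K.IsCyclic N v).card * (n - 2 * N) ≤
      C * Fintype.card (ConstraintGraph r c n) := by
  refine ⟨∑ k ∈ Finset.range N, Fintype.card (Fin (2 * (k + 1)) → (Fin r × Fin c) × Bool) *
    (2 * (k + 1) * (2 * (k + 1))), fun n v => ?_⟩
  let e : ConstraintGraph r c n ≃ (Fin r × Fin c → Equiv.Perm (Fin n)) :=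
    (Equiv.curry (Fin r) (Fin c) (Equiv.Perm (Fin n))).symm
  have hcard : Fintype.card (ConstraintGraph r c n) =
      Fintype.card (Fin r × Fin c → Equiv.Perm (Fin n)) := Fintype.card_congr e
  set S : ℕ → Finset (Fin r × Fin c → Equiv.Perm (Fin n)) := fun k => Finset.univ.filter fun σ =>
    ∃ x : ℕ → (Fin r × Fin c) × Bool, ReducedUpTo (2 * (k + 1)) x ∧
      trail σ x v.2 (2 * (k + 1)) = v.2 with hS
  have hle : (Finset.univ.filter fun K : ConstraintGraph r c n => K.IsCyclic N v).card ≤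
      ∑ k ∈ Finset.range N, (S k).card := by
    refine le_trans ?_ Finset.card_biUnion_le
    refine Finset.card_le_card_of_injOn e ?_ e.injective.injOn
    intro K hK
    obtain ⟨k, hk, x, hx⟩ := (Finset.mem_filter.1 (Finset.mem_coe.1 hK)).2
    exact Finset.mem_coe.2 (Finset.mem_biUnion.2 ⟨k, Finset.mem_range.2 hk,
      Finset.mem_filter.2 ⟨Finset.mem_univ _, x, hx⟩⟩)
  refine (Nat.mul_le_mul_right _ hle).trans ?_
  rw [Finset.sum_mul, Finset.sum_mul, hcard]
  refine Finset.sum_le_sum fun k hk => ?_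
  have hk := Finset.mem_range.1 hk
  have h := card_exists_trail_eq_mul_le (E := Fin r × Fin c) v.2 (m := 2 * (k + 1)) (by omega)
  rw [Fintype.card_fin] at h
  refine (Nat.mul_le_mul_left _ (by omega : n - 2 * N ≤ n - 2 * (k + 1))).trans (h.trans_eq ?_)
  ring

open Classical in
/-- The number of vertices at which a short closed reduced word starts. -/
noncomputable def cyclicCount (K : ConstraintGraph r c n) (N : ℕ) : ℕ :=
  (Finset.univ.filter fun v => K.IsCyclic N v).card

open Classical in
theorem sum_cyclicCount (n N : ℕ) : ∑ K : ConstraintGraph r c n, K.cyclicCount N =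
    ∑ v : VarVertex r n,
      (Finset.univ.filter fun K : ConstraintGraph r c n => K.IsCyclic N v).card := by
  simp only [cyclicCount, Finset.card_filter]
  exact Finset.sum_comm

open Classical in
/-- In all but a fraction `O(1 / n)` of the lifts, few short closed reduced words exist. -/
theorem card_lt_cyclicCount_le (r c N : ℕ) : ∃ C : ℕ, ∀ (n : ℕ) (δ : ℝ), 0 < δ → 0 < r →
    2 * N < n →
    ((Finset.univ.filter fun K : ConstraintGraph r c n =>
      δ * (r * n) < K.cyclicCount N).card : ℝ) ≤
      C / (δ * (n - 2 * N)) * Fintype.card (ConstraintGraph r c n) := by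
  obtain ⟨C, hC⟩ := card_isCyclic_mul_le r c N
  refine ⟨C, fun n δ hδ hr hn => ?_⟩
  set T := Fintype.card (ConstraintGraph r c n)
  set S := Finset.univ.filter fun K : ConstraintGraph r c n => δ * (r * n) < K.cyclicCount N
  have hsum : (∑ K : ConstraintGraph r c n, K.cyclicCount N) * (n - 2 * N) ≤ r * n * (C * T) := by
    rw [sum_cyclicCount, Finset.sum_mul]
    refine (Finset.sum_le_card_nsmul _ _ _ fun v _ => hC n v).trans_eq ?_
    rw [Finset.card_univ, Fintype.card_prod, Fintype.card_fin, Fintype.card_fin, smul_eq_mul]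
  have hmarkov : (S.card : ℝ) * (δ * (r * n)) ≤
      ((∑ K : ConstraintGraph r c n, K.cyclicCount N : ℕ) : ℝ) := by
    push_cast
    calc (S.card : ℝ) * (δ * (r * n)) ≤ ∑ K ∈ S, (K.cyclicCount N : ℝ) := by
          rw [← nsmul_eq_mul]
          exact Finset.card_nsmul_le_sum _ _ _ fun K hK => (Finset.mem_filter.1 hK).2.le
      _ ≤ _ := Finset.sum_le_univ_sum_of_nonneg fun _ => Nat.cast_nonneg _
  have hn' : (0 : ℝ) < n - 2 * N := by
    rw [sub_pos]
    exact_mod_cast hn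
  have hsum' : ((∑ K : ConstraintGraph r c n, K.cyclicCount N : ℕ) : ℝ) * (n - 2 * N) ≤
      r * n * (C * T) := by
    have := (Nat.cast_le (α := ℝ)).2 hsum
    rw [Nat.cast_mul, Nat.cast_sub hn.le] at this
    push_cast at this ⊢
    exact this
  have hrn : (0 : ℝ) < r * n := by
    have : 0 < n := by omega
    positivity
  rw [div_mul_eq_mul_div, le_div_iff₀ (mul_pos hδ hn')]
  refine le_of_mul_le_mul_right ?_ hrn
  calc (S.card : ℝ) * (δ * (n - 2 * N)) * (r * n) = S.card * (δ * (r * n)) * (n - 2 * N) := by ring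
    _ ≤ _ := mul_le_mul_of_nonneg_right hmarkov hn'.le
    _ ≤ _ := hsum'
    _ = _ := by ring

end ConstraintGraph

/-! ### Choice of parameters and conclusion. -/

/-- For `c = 1` the coefficient `β 1` vanishes and only degree one can be normalized; then `L = 0`
suffices because `γ = 0`. Otherwise any large `L` works. -/
theorem exists_length_liftBeta {c : ℕ} (hc : 1 ≤ c) {d ε : ℝ} (hd : 0 < d) (hε : 0 < ε) :
    ∃ L : ℕ, (∀ k < L + 1, 0 < liftBeta d c k) ∧ 2 * √(d * (c - 1)) / (L + 1) ≤ ε := by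
  have hc0 : (0 : ℝ) < c := by exact_mod_cast hc
  rcases hc.eq_or_lt with rfl | hc2
  · refine ⟨0, fun k hk => ?_, ?_⟩
    · obtain rfl : k = 0 := by omega
      simpa [liftBeta] using hd
    · simpa using hε.le
  · have hc1 : (0 : ℝ) < c - 1 := by
      rw [sub_pos]
      exact_mod_cast hc2
    obtain ⟨L, hL⟩ := exists_nat_gt (2 * √(d * (c - 1)) / ε)
    refine ⟨L, fun k _ => ?_, ?_⟩
    · rw [liftBeta]
      split_ifs
      · exact mul_pos hd hc0
      · exact mul_pos hd hc1
    · rw [div_lt_iff₀ hε] at hL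
      rw [div_le_iff₀ (by positivity)]
      linarith

namespace ConstraintGraph

/-- Lifts with few short closed reduced words have feasible matrices close to both ends of the
spectrum of the universal cover. -/
theorem exists_isSDPFeasible_of_cyclicCount_le {r c : ℕ} (hc : 1 ≤ c) (A : Fin c → Atom r)
    {l₁ l₂ : ℝ} (hl : l₁ ≠ l₂) (hA : ∀ j, spectrum ℝ (A j).adj = {l₁, l₂}) {ε : ℝ} (hε : 0 < ε) :
    ∃ N : ℕ, ∃ δ : ℝ, 0 < δ ∧ ∀ (n : ℕ) (K : ConstraintGraph r c n)
      (ξ : ConVertex c n → Fin r → ℤˣ), 0 < r → 0 < n → (K.cyclicCount N : ℝ) ≤ δ * (r * n) →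
      ∀ σ ∈ ({1, -1} : Set ℝ), ∃ M : Matrix (VarVertex r n) (VarVertex r n) ℝ, IsSDPFeasible M ∧
        |matInner (K.instanceAdj A ξ) M -
          (l₁ + l₂ + 2 * σ * √(((c : ℝ) - 1) * (-(l₁ * l₂)))) * (r * n)| ≤ ε * (r * n) := by
  classical
  set d : ℝ := -(l₁ * l₂) with hd_def
  have hd : 0 < d := (A ⟨0, hc⟩).neg_eigenvalue_mul_pos hl (hA _)
  set s := l₁ + l₂
  rw [mul_comm ((c : ℝ) - 1) d]
  set γ := d * ((c : ℝ) - 1) with hγ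
  set β := liftBeta d c with hβ
  obtain ⟨L, hpos, hL⟩ := exists_length_liftBeta hc hd (half_pos hε)
  set R : ℝ := c * r
  have hR : 0 ≤ R := by positivity
  set D : ℝ → ℝ := fun σ =>
    R * (∑ i ∈ (testPoly s β σ (L + 1) * testPoly s β σ (L + 1)).support,
      |(testPoly s β σ (L + 1) * testPoly s β σ (L + 1)).coeff i| * R ^ i) / (L + 1) with hD
  have hD0 : ∀ σ, 0 ≤ D σ := fun σ => by positivity
  set τ : ℝ → ℝ := fun σ => s + 2 * σ * (L / (L + 1) * √γ) with hτ
  -- `Q` bounds the loss per bad vertex for both signs; the `+ 1` makes it positive.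
  set Q : ℝ := D 1 + |τ 1| + (D (-1) + |τ (-1)|) + 1 with hQ
  have hQ0 : 0 < Q := by
    have := hD0 1
    have := hD0 (-1)
    positivity
  have hQσ : ∀ σ ∈ ({1, -1} : Set ℝ), D σ + |τ σ| ≤ Q := by
    have h1 := hD0 1
    have h2 := hD0 (-1)
    have h3 := abs_nonneg (τ 1)
    have h4 := abs_nonneg (τ (-1))
    rintro σ (rfl | rfl) <;> linarith
  -- Half of `ε` pays for the bad vertices, the other half for replacing `L / (L + 1)` by `1`.
  refine ⟨2 * L + 3, ε / 2 / Q, by positivity, ?_⟩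
  intro n K ξ hr hn hcount σ hσmem
  have hσ : σ ^ 2 = 1 := by rcases hσmem with rfl | rfl <;> norm_num
  have hσabs : |σ| = 1 := by rcases hσmem with rfl | rfl <;> norm_num
  have : Nonempty (VarVertex r n) := ⟨(⟨0, hr⟩, ⟨0, hn⟩)⟩
  set good : Finset (VarVertex r n) := Finset.univ.filter fun v => ¬ K.IsCyclic (2 * L + 3) v
  have hbad : goodᶜ.card = K.cyclicCount (2 * L + 3) := by
    rw [cyclicCount]
    congr 1
    ext v
    simp [good]
  obtain ⟨M, hM, hMb⟩ := exists_isSDPFeasible_of_jacobi (K.instanceAdj A ξ)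
    (K.instanceAdj_isSymm A ξ) (K.instanceAdj_self A ξ) hR (K.sum_abs_instanceAdj_le A ξ) s β γ
    (fun k => by simp [hβ, liftBeta, hγ]) σ hσ L hpos good
    (fun v hv k h1 h2 => K.aeval_jacobiPoly_instanceAdj_eq_zero A hA ξ
      (Finset.mem_filter.1 hv).2 h1 h2)
  refine ⟨M, hM, ?_⟩
  have hMb : |matInner (K.instanceAdj A ξ) M - good.card * τ σ| ≤ goodᶜ.card * D σ := hMb
  have hgc : (good.card : ℝ) + goodᶜ.card = r * n := by
    rw [← Nat.cast_add, Finset.card_add_card_compl, Fintype.card_prod, Fintype.card_fin,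
      Fintype.card_fin, Nat.cast_mul]
  have hrn : (0 : ℝ) ≤ r * n := by positivity
  have hτσ : |τ σ - (s + 2 * σ * √γ)| ≤ ε / 2 := by
    have e : τ σ - (s + 2 * σ * √γ) = -σ * (2 * √γ / (L + 1)) := by
      rw [hτ]
      field_simp
      ring
    rw [e, abs_mul, abs_neg, hσabs, one_mul, abs_of_nonneg (by positivity)]
    exact hL
  have hbadle : (goodᶜ.card : ℝ) * (D σ + |τ σ|) ≤ ε / 2 * (r * n) := by
    rw [hbad]
    calc (K.cyclicCount (2 * L + 3) : ℝ) * (D σ + |τ σ|)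
        ≤ (ε / 2 / Q * (r * n)) * Q :=
          mul_le_mul hcount (hQσ σ hσmem) (add_nonneg (hD0 σ) (abs_nonneg _)) (by positivity)
      _ = ε / 2 * (r * n) := by field_simp
  calc |matInner (K.instanceAdj A ξ) M - (s + 2 * σ * √γ) * (r * n)|
      = |(matInner (K.instanceAdj A ξ) M - good.card * τ σ) + (-(goodᶜ.card * τ σ)
          + (τ σ - (s + 2 * σ * √γ)) * (r * n))| := by
        congr 1
        linear_combination (τ σ) * hgc
    _ ≤ goodᶜ.card * D σ + (goodᶜ.card * |τ σ| + ε / 2 * (r * n)) := by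
        refine (abs_add_le _ _).trans (add_le_add hMb ((abs_add_le _ _).trans (add_le_add ?_ ?_)))
        · rw [abs_neg, abs_mul, Nat.abs_cast]
        · rw [abs_mul, abs_of_nonneg hrn]
          exact mul_le_mul_of_nonneg_right hτσ hrn
    _ ≤ ε * (r * n) := by linarith

/-- A random lift has few short closed reduced words with high probability. -/
theorem tendsto_measure_lt_cyclicCount {r c : ℕ} (hr : 0 < r) (N : ℕ) {δ : ℝ} (hδ : 0 < δ)
    (Ω : ℕ → Type*) [∀ n, MeasurableSpace (Ω n)] (μ : ∀ n, Measure (Ω n))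
    (K : ∀ n, Ω n → ConstraintGraph r c n) (hK : ∀ n, Measurable (K n))
    (hunif : ∀ n, (μ n).map (K n) = uniformOn Set.univ) :
    Filter.Tendsto (fun n => μ n {ω | δ * (r * n) < (K n ω).cyclicCount N}) Filter.atTop
      (nhds 0) := by
  classical
  obtain ⟨C, hC⟩ := card_lt_cyclicCount_le r c N
  have hlim : Filter.Tendsto (fun n : ℕ => ENNReal.ofReal (C / (δ * ((n : ℝ) - 2 * N))))
      Filter.atTop (nhds 0) := by
    rw [← ENNReal.ofReal_zero]
    refine ENNReal.tendsto_ofReal (Filter.Tendsto.const_div_atTop ?_ _)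
    refine Filter.Tendsto.const_mul_atTop hδ ?_
    exact Filter.tendsto_atTop_add_const_right _ _ tendsto_natCast_atTop_atTop
  refine tendsto_of_tendsto_of_tendsto_of_le_of_le' tendsto_const_nhds hlim
    (Filter.Eventually.of_forall fun _ => zero_le) ?_
  filter_upwards [Filter.eventually_gt_atTop (2 * N)] with n hn
  set S : Finset (ConstraintGraph r c n) :=
    Finset.univ.filter fun K => δ * (r * n) < K.cyclicCount N with hS
  have hmeas : MeasurableSet (S : Set (ConstraintGraph r c n)) := trivial
  have huniv : MeasurableSet
      (↑(Finset.univ : Finset (ConstraintGraph r c n)) : Set (ConstraintGraph r c n)) := trivial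
  have e : {ω | δ * (r * n) < (K n ω).cyclicCount N} = K n ⁻¹' (S : Set _) := by
    ext ω
    simp [hS]
  have : Nonempty (ConstraintGraph r c n) := ⟨fun _ _ => 1⟩
  have hT : (0 : ℝ) < Fintype.card (ConstraintGraph r c n) := by
    exact_mod_cast Fintype.card_pos
  rw [e, ← Measure.map_apply (hK n) hmeas, hunif n, ← Finset.coe_univ,
    uniformOn_apply_finset' huniv hmeas, Finset.univ_inter, Finset.card_univ]
  rw [← ENNReal.ofReal_natCast, ← ENNReal.ofReal_natCast, ← ENNReal.ofReal_div_of_pos hT]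
  refine ENNReal.ofReal_le_ofReal ?_
  rw [div_le_iff₀ hT]
  exact hC n δ hδ hr hn

end ConstraintGraph

theorem mainTheorem8 {r c : ℕ} (hc : 1 ≤ c) (A : Fin c → Atom r) (l₁ l₂ : ℝ) (hl : l₁ ≠ l₂)
    (hA : ∀ j, spectrum ℝ (A j).adj = {l₁, l₂})
    (Ω : ℕ → Type*) [∀ n, MeasurableSpace (Ω n)]
    (μ : ∀ n, MeasureTheory.Measure (Ω n)) [∀ n, MeasureTheory.IsProbabilityMeasure (μ n)]
    (K : ∀ n, Ω n → ConstraintGraph r c n) (ξ : ∀ n, Ω n → ConVertex c n → Fin r → ℤˣ)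
    (hK : ∀ n, IsRandomNegatedLift (μ n) (K n) (ξ n))
    (ε : ℝ) (hε : 0 < ε) :
    Filter.Tendsto
      (fun n => μ n {ω | ∃ Mp Mm : Matrix (VarVertex r n) (VarVertex r n) ℝ,
        IsSDPFeasible Mp ∧ IsSDPFeasible Mm ∧
        (l₁ + l₂ + 2 * √(((c : ℝ) - 1) * (-(l₁ * l₂))) - ε) * (Fintype.card (VarVertex r n) : ℝ)
          ≤ matInner ((K n ω).instanceAdj A (ξ n ω)) Mp ∧
        matInner ((K n ω).instanceAdj A (ξ n ω)) Mm
          ≤ (l₁ + l₂ - 2 * √(((c : ℝ) - 1) * (-(l₁ * l₂))) + ε)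
            * (Fintype.card (VarVertex r n) : ℝ)})
      Filter.atTop (nhds 1) := by
  -- The empty matrix has empty spectrum.
  have hr : 0 < r := by
    rcases Nat.eq_zero_or_pos r with rfl | hr
    · have h := hA ⟨0, hc⟩
      rw [spectrum.of_subsingleton] at h
      exact absurd h (Set.insert_nonempty _ _).ne_empty.symm
    · exact hr
  obtain ⟨N, δ, hδ, hdet⟩ :=
    ConstraintGraph.exists_isSDPFeasible_of_cyclicCount_le hc A hl hA hε
  have hbad := ConstraintGraph.tendsto_measure_lt_cyclicCount hr N hδ Ω μ K
    (fun n => (hK n).measurable_lift) (fun n => (hK n).lift_uniform)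
  have hone : Filter.Tendsto
      (fun n => 1 - μ n {ω | δ * (r * n) < (K n ω).cyclicCount N}) Filter.atTop (nhds 1) := by
    simpa using ENNReal.Tendsto.sub tendsto_const_nhds hbad (Or.inl ENNReal.one_ne_top)
  refine tendsto_of_tendsto_of_tendsto_of_le_of_le' hone tendsto_const_nhds ?_
    (Filter.Eventually.of_forall fun n => prob_le_one)
  filter_upwards [Filter.eventually_gt_atTop 0] with n hn
  have hmeas : MeasurableSet {ω | δ * (r * n) < (K n ω).cyclicCount N} :=
    (hK n).measurable_lift (t := {κ | δ * (r * n) < κ.cyclicCount N}) trivial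
  rw [← prob_compl_eq_one_sub hmeas]
  -- The target event is not shown to be measurable; it suffices that it contains the complement of
  -- the measurable bad event.
  refine measure_mono fun ω hω => ?_
  have hω : ((K n ω).cyclicCount N : ℝ) ≤ δ * (r * n) := not_lt.1 hω
  obtain ⟨Mp, hMp, hp⟩ := hdet n (K n ω) (ξ n ω) hr hn hω 1 (by simp)
  obtain ⟨Mm, hMm, hm⟩ := hdet n (K n ω) (ξ n ω) hr hn hω (-1) (by simp)
  have hcard : (Fintype.card (VarVertex r n) : ℝ) = r * n := by
    rw [Fintype.card_prod, Fintype.card_fin, Fintype.card_fin, Nat.cast_mul]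
  refine ⟨Mp, Mm, hMp, hMm, ?_, ?_⟩
  · rw [hcard]
    have := (abs_le.1 hp).1
    linarith
  · rw [hcard]
    have := (abs_le.1 hm).2
    linarith
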